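/- Consider the real state-space system $\dot x = Ax + Lv + Bu$, $y = Cx$, with $x\in\mathbb{R}^n$, $v\in\mathbb{R}^m$, $u\in\mathbb{R}^q$, $y\in\mathbb{R}^p$, $m<p$. Put $G_{yv}=C(sI-A)^{-1}L$ and $G_{yu}=C(sI-A)^{-1}B$, and let $c_i$ be the $i$th row of $C$. Let $\mathcal{RP}$ be the set of proper real rational transfer matrices, and $\mathcal{RH}_\infty$ the set of those whose poles all lie in the open left half-plane. A controller $K\in\mathcal{RP}$ is an output-rectifying retrofit controller if $KG_{yv}=0$ and $(I-KG_{yu})^{-1}K\in\mathcal{RH}_\infty$. Relative-degree assumption: $G_{yv}$ has relative degree $(r_1,\dots,r_p)$, that is, $r_i\ge 1$, $c_iA^{j}L=0$ for $0\le j\le r_i-2$, $c_iA^{r_i-1}L\neq 0$, and the matrix with rows $c_iA^{r_i-1}L$ $(i=1,\dots,p)$ is injective. Moreover $r_1\le\cdots\le r_p$, $r_m<r_{m+1}$, and the matrix with rows $c_iA^{r_i-1}L$ $(i=1,\dots,m)$ is injective. Let $P=[0\ I]$ and $\bar P=[I\ 0]$ select the last $p-m$ and the first $m$ entries of $y$.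 Let $S$ be the matrix with rows $c_iA^{j-1}$ $(1\le i\le m,\ 1\le j\le r_i)$. Let $\bar S$ be a matrix such that $\begin{bmatrix}S\\ \bar S\end{bmatrix}$ is square and invertible, with inverse $[S^\dagger\ \bar S^\dagger]$, and such that $\bar SL=0$ and $PCS^\dagger=0$. Put $\hat A=\bar SA\bar S^\dagger$, $\hat C=PC\bar S^\dagger$, and $$\hat G_{yv}=\hat C(sI-\hat A)^{-1}\bar SAS^\dagger D_\xi,\qquad D_\xi=\mathrm{diag}\big([1\ s\ \cdots\ s^{r_i-1}]^{\sf T}\big)_{i=1}^m,$$ $$\hat G_{yu}=\hat C(sI-\hat A)^{-1}\bar S\big(B-AS^\dagger\,\mathrm{col}(Z_i\hat D_i)_{i=1}^m\big),\qquad \hat D_i=\mathrm{col}(s^{j-1}I)_{j=1}^{r_i},$$ where $Z_i$ is the strictly lower block triangular matrix whose block in row $j$ and column $l$ is $c_iA^{j-l-1}B$ for $l<j$ and $0$ for $l\ge j$ $(1\le j,l\le r_i)$. Put $R=[I\ \ -\hat G_{yv}]$. Theorem. Under the relative-degree assumption, such an $\bar S$ exists. For every such $\bar S$, $\hat G_{yv}$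 and $\hat G_{yu}$ are proper, and for all $K,\hat K\in\mathcal{RP}$ of compatible sizes $I-KG_{yu}$ and $I-\hat K\hat G_{yu}$ are invertible over the field of real rational functions. Moreover, for every such $\bar S$, a controller $K\in\mathcal{RP}$ is an output-rectifying retrofit controller if and only if there exists $\hat K\in\mathcal{RP}$ such that $$K=\hat KR\,[P^{\sf T}\ \bar P^{\sf T}]^{\sf T},\qquad \hat Q:=(I-\hat K\hat G_{yu})^{-1}\hat K\in\mathcal{RH}_\infty,\qquad \hat Q\hat G_{yv}\in\mathcal{RH}_\infty .$$ -/

import Mathlib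

noncomputable section

namespace Retrofit

open Matrix

/-- Real rational transfer matrices; the variable `s` is `RatFunc.X`. -/
abbrev TF (α β : Type) : Type := Matrix α β (RatFunc ℝ)

/-- A real matrix regarded as a constant transfer matrix. -/
def const {α β : Type} (M : Matrix α β ℝ) : TF α β := M.map (RatFunc.C : ℝ →+* RatFunc ℝ)

/-- Proper transfer matrices: in every entry, the degree of the numerator is at most the degree of
the denominator. -/
def IsProper {α β : Type} (G : TF α β) : Prop :=
  ∀ i j, (G i j).num.natDegree ≤ (G i j).denom.natDegree

/-- The class `RH∞`: proper transfer matrices all of whose poles (zeros of the reduced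
denominators of the entries) lie in the open left half-plane. -/
def IsRHInf {α β : Type} (G : TF α β) : Prop :=
  IsProper G ∧ ∀ i j, ∀ z : ℂ, Polynomial.aeval z (G i j).denom = 0 → z.re < 0

/-- The resolvent `(sI - A)⁻¹`. -/
def resolvent {n : ℕ} (A : Matrix (Fin n) (Fin n) ℝ) : TF (Fin n) (Fin n) :=
  ((RatFunc.X : RatFunc ℝ) • (1 : TF (Fin n) (Fin n)) - const A)⁻¹

/-- `G` with relative degree `(r₁, …, r_p)`, where `(A, B, C)` is a realization of `G`. -/
def HasRelativeDegree {n m p : ℕ} (A : Matrix (Fin n) (Fin n) ℝ) (B : Matrix (Fin n) (Fin m) ℝ)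
    (C : Matrix (Fin p) (Fin n) ℝ) (r : Fin p → ℕ) : Prop :=
  (∀ i, 1 ≤ r i) ∧
  (∀ i, ∀ j : ℕ, j + 2 ≤ r i → (C * A ^ j * B) i = 0) ∧
  (∀ i, (C * A ^ (r i - 1) * B) i ≠ 0) ∧
  Function.Injective
    (Matrix.mulVec (Matrix.of fun (i : Fin p) (a : Fin m) => (C * A ^ (r i - 1) * B) i a))

/-- The subsystem of interest `ẋ = A x + L v + B u`, `y = C x`, with `n` states, an interconnection
input `v` of dimension `m`, a control input `u` of dimension `q`, and `m + k` measured outputs. -/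
structure Subsystem (n m k q : ℕ) where
  A : Matrix (Fin n) (Fin n) ℝ
  L : Matrix (Fin n) (Fin m) ℝ
  B : Matrix (Fin n) (Fin q) ℝ
  C : Matrix (Fin (m + k)) (Fin n) ℝ

/-- `P = [0 I]`, which selects the last `k` outputs. -/
def P (m k : ℕ) : Matrix (Fin k) (Fin (m + k)) ℝ :=
  (1 : Matrix (Fin (m + k)) (Fin (m + k)) ℝ).submatrix (Fin.natAdd m) id

/-- `P̄ = [I 0]`, which selects the first `m` outputs. -/
def Pbar (m k : ℕ) : Matrix (Fin m) (Fin (m + k)) ℝ :=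
  (1 : Matrix (Fin (m + k)) (Fin (m + k)) ℝ).submatrix (Fin.castAdd k) id

namespace Subsystem

variable {n m k q : ℕ}

/-- `G_yv = C (sI - A)⁻¹ L`. -/
def Gyv (G : Subsystem n m k q) : TF (Fin (m + k)) (Fin m) :=
  const G.C * resolvent G.A * const G.L

/-- `G_yu = C (sI - A)⁻¹ B`. -/
def Gyu (G : Subsystem n m k q) : TF (Fin (m + k)) (Fin q) :=
  const G.C * resolvent G.A * const G.B

/-- `K` is an output-rectifying retrofit controller: `K G_yv = 0` and
`Q = (I - K G_yu)⁻¹ K` belongs to `RH∞`. -/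
def IsOutputRectifying (G : Subsystem n m k q) (K : TF (Fin q) (Fin (m + k))) : Prop :=
  K * G.Gyv = 0 ∧ IsRHInf ((1 - K * G.Gyu)⁻¹ * K)

/-- The relative-degree assumption: `G_yv` has relative degree `r₁ ≤ ⋯ ≤ r_{m+k}`, with
`r_m < r_{m+1}` (so each of the first `m` degrees is smaller than each of the others), and the
matrix with rows `c_i A^{r_i - 1} L`, `i = 1, …, m`, is injective. -/
def RelDegAssumption (G : Subsystem n m k q) (r : Fin (m + k) → ℕ) : Prop :=
  HasRelativeDegree G.A G.L G.C r ∧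
  Monotone r ∧
  (∀ (i : Fin m) (j : Fin k), r (Fin.castAdd k i) < r (Fin.natAdd m j)) ∧
  Function.Injective
    (Matrix.mulVec (Matrix.of fun (i : Fin m) (a : Fin m) =>
      (G.C * G.A ^ (r (Fin.castAdd k i) - 1) * G.L) (Fin.castAdd k i) a))

/-- The index set of `ξ`: pairs `(i, j)` with `i` among the first `m` outputs and `0 ≤ j < r_i`. -/
abbrev XiIdx (m k : ℕ) (r : Fin (m + k) → ℕ) : Type :=
  (i : Fin m) × Fin (r (Fin.castAdd k i))

/-- `S`, the matrix with rows `c_i A^j`, `1 ≤ i ≤ m`, `0 ≤ j < r_i`. -/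
def S (G : Subsystem n m k q) (r : Fin (m + k) → ℕ) : Matrix (XiIdx m k r) (Fin n) ℝ :=
  Matrix.of fun a l => (G.C * G.A ^ (a.2 : ℕ)) (Fin.castAdd k a.1) l

/-- Normal-form coordinates `x ↦ (ξ, z) = (S x, S̄ x)`: the matrix `S̄` completes `S` to a
coordinate transformation with inverse `[S† S̄†]`, it annihilates `L`, and the outputs `P y` do
not depend on `ξ`, that is `P C S† = 0`. -/
structure NormalForm (G : Subsystem n m k q) (r : Fin (m + k) → ℕ) (ν : ℕ) where
  Sbar : Matrix (Fin ν) (Fin n) ℝ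
  Sdag : Matrix (Fin n) (XiIdx m k r) ℝ
  Sbardag : Matrix (Fin n) (Fin ν) ℝ
  right_inv : fromRows (G.S r) Sbar * fromCols Sdag Sbardag = 1
  left_inv : fromCols Sdag Sbardag * fromRows (G.S r) Sbar = 1
  Sbar_mul_L : Sbar * G.L = 0
  PC_mul_Sdag : P m k * G.C * Sdag = 0

/-- `D_ξ = diag([1 s ⋯ s^{r_i - 1}]ᵀ)`, `i = 1, …, m`. -/
def Dxi (m k : ℕ) (r : Fin (m + k) → ℕ) : TF (XiIdx m k r) (Fin m) :=
  Matrix.of fun a i => if a.1 = i then (RatFunc.X : RatFunc ℝ) ^ (a.2 : ℕ) else 0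

/-- The strictly lower block triangular Toeplitz matrix `Z_i`: its block in row `j` and column `l`
(counted from `0`) is `c_i A^{j - 1 - l} B` if `l < j`, and `0` otherwise. -/
def Z (G : Subsystem n m k q) (r : Fin (m + k) → ℕ) (i : Fin m) :
    Matrix (Fin (r (Fin.castAdd k i))) (Fin (r (Fin.castAdd k i)) × Fin q) ℝ :=
  Matrix.of fun j b =>
    if (b.1 : ℕ) < (j : ℕ) then
      (G.C * G.A ^ ((j : ℕ) - 1 - (b.1 : ℕ)) * G.B) (Fin.castAdd k i) b.2
    else 0

/-- `D̂ = col(I, s I, …, s^{d - 1} I)` with identity blocks of size `q`. -/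
def Dhat (d q : ℕ) : TF (Fin d × Fin q) (Fin q) :=
  Matrix.of fun b c => if b.2 = c then (RatFunc.X : RatFunc ℝ) ^ (b.1 : ℕ) else 0

/-- `col(Z_i D̂_i)`, `i = 1, …, m`. -/
def ZD (G : Subsystem n m k q) (r : Fin (m + k) → ℕ) : TF (XiIdx m k r) (Fin q) :=
  Matrix.of fun a c =>
    (const (G.Z r a.1) * Dhat (r (Fin.castAdd k a.1)) q) a.2 c

namespace NormalForm

variable {G : Subsystem n m k q} {r : Fin (m + k) → ℕ} {ν : ℕ}

/-- `Â = S̄ A S̄†`. -/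
def Ahat (N : G.NormalForm r ν) : Matrix (Fin ν) (Fin ν) ℝ := N.Sbar * G.A * N.Sbardag

/-- `Ĉ = P C S̄†`. -/
def Chat (N : G.NormalForm r ν) : Matrix (Fin k) (Fin ν) ℝ := P m k * G.C * N.Sbardag

/-- `Ĝ_yv = Ĉ (sI - Â)⁻¹ S̄ A S† D_ξ`. -/
def Gyvhat (N : G.NormalForm r ν) : TF (Fin k) (Fin m) :=
  const N.Chat * resolvent N.Ahat * const (N.Sbar * G.A * N.Sdag) * Dxi m k r

/-- `Ĝ_yu = Ĉ (sI - Â)⁻¹ S̄ (B - A S† col(Z_i D̂_i))`. -/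
def Gyuhat (N : G.NormalForm r ν) : TF (Fin k) (Fin q) :=
  const N.Chat * resolvent N.Ahat * const N.Sbar *
    (const G.B - const (G.A * N.Sdag) * G.ZD r)

/-- The rectifier `R = [I  -Ĝ_yv]`. -/
def R (N : G.NormalForm r ν) : TF (Fin k) (Fin k ⊕ Fin m) := fromCols 1 (-N.Gyvhat)

/-- `Q̂ = (I - K̂ Ĝ_yu)⁻¹ K̂`. -/
def Qhat (N : G.NormalForm r ν) (Khat : TF (Fin q) (Fin k)) : TF (Fin q) (Fin k) :=
  (1 - Khat * N.Gyuhat)⁻¹ * Khat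

end NormalForm

end Subsystem

end Retrofit

end

/-! In the coordinates `ξ = S x`, `z = S̄ x`, the input `v` does not enter the equation of `z`
directly, and `P y` depends on `z` alone. The entries of `ξ` are derivatives of `P̄ y`, corrected by
polynomial terms in `u`. Eliminating `ξ` from the `z`-equation gives `P G_yv = Ĝ_yv P̄ G_yv` and `P
G_yu = Ĝ_yv P̄ G_yu + Ĝ_yu` (`P_mul_Gyv`, `P_mul_Gyu`), so `R [P; P̄]` annihilates `G_yv` and turns
`G_yu` into `Ĝ_yu`.

Since `P̄ G_yv` is square and invertible, every `K` with `K G_yv = 0` factors through `R [P; P̄]`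
with `K̂ = K Pᵀ` (`eq_mul_R_of_mul_Gyv_eq_zero`). Then `K G_yu = K̂ Ĝ_yu`, and `(I - K G_yu)⁻¹ K =
Q̂ P - Q̂ Ĝ_yv P̄`, whose two column blocks carry the two stability conditions (`isRHInf_iff`).

Properness is measured by the valuation at infinity. The gap `r_i < r_{m+j}` makes `Ĝ_yv`, and hence
`Ĝ_yu`, strictly proper; all the loops are then well posed by `isUnit_one_sub`. For existence, `S̄`
comes from the projection onto `ker S` along the span of the columns of `reach`. -/

noncomputable section

namespace Retrofit

open Matrix WithZero

variable {α β γ : Type}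

/-! ### Degree at infinity and well-posedness -/

open scoped Classical in
/-- The valuation of the real rational functions at infinity. -/
def inftyVal : Valuation (RatFunc ℝ) ℤᵐ⁰ := RatFunc.inftyValuation ℝ

open scoped Classical in
theorem inftyVal_of_ne_zero {x : RatFunc ℝ} (hx : x ≠ 0) : inftyVal x = exp x.intDegree := by
  rw [inftyVal, RatFunc.inftyValuation_apply, RatFunc.inftyValuation_of_nonzero _ hx]

theorem inftyVal_X : inftyVal RatFunc.X = exp (1 : ℤ) := by
  rw [inftyVal, RatFunc.inftyValuation.X]

open scoped Classical in
theorem inftyVal_C_le (c : ℝ) : inftyVal (RatFunc.C c) ≤ exp (0 : ℤ) := by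
  by_cases hc : c = 0
  · simp [hc]
  · rw [inftyVal, RatFunc.inftyValuation.C _ hc, exp_zero]

/-- All entries of `M` have degree (numerator degree minus denominator degree) at most `d`. -/
def DegLE (d : ℤ) (M : TF α β) : Prop :=
  ∀ i j, inftyVal (M i j) ≤ exp d

theorem num_natDegree_le_iff (x : RatFunc ℝ) :
    x.num.natDegree ≤ x.denom.natDegree ↔ inftyVal x ≤ exp (0 : ℤ) := by
  by_cases hx : x = 0
  · simp [hx]
  · rw [inftyVal_of_ne_zero hx, exp_le_exp,
      RatFunc.intDegree]
    omega

theorem isProper_iff_degLE {G : TF α β} : IsProper G ↔ DegLE 0 G :=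
  forall_congr' fun _ => forall_congr' fun _ => num_natDegree_le_iff _

namespace DegLE

theorem mono {d e : ℤ} {M : TF α β} (h : DegLE d M) (hde : d ≤ e) : DegLE e M :=
  fun i j => (h i j).trans (exp_le_exp.2 hde)

theorem add {d : ℤ} {M N : TF α β} (hM : DegLE d M) (hN : DegLE d N) : DegLE d (M + N) :=
  fun i j => Valuation.map_add_le _ (hM i j) (hN i j)

theorem neg {d : ℤ} {M : TF α β} (hM : DegLE d M) : DegLE d (-M) :=
  fun i j => by simpa only [Matrix.neg_apply, Valuation.map_neg] using hM i j

theorem sub {d : ℤ} {M N : TF α β} (hM : DegLE d M) (hN : DegLE d N) : DegLE d (M - N) := by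
  simpa only [sub_eq_add_neg] using hM.add hN.neg

theorem mul [Fintype β] {d e : ℤ} {M : TF α β} {N : TF β γ} (hM : DegLE d M) (hN : DegLE e N) :
    DegLE (d + e) (M * N) := fun i j => by
  rw [Matrix.mul_apply]
  refine Valuation.map_sum_le _ fun a _ => ?_
  rw [map_mul, exp_add]
  exact mul_le_mul' (hM i a) (hN a j)

theorem const (M : Matrix α β ℝ) : DegLE 0 (const M) :=
  fun i j => inftyVal_C_le (M i j)

/-- Over the valuation ring at infinity the entries of `N` lie in the maximal ideal, so `1 - N`
reduces to the identity over the residue field. Its determinant is therefore a unit of the ring, and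
the inverse has entries in the ring, i.e. is proper. -/
theorem isUnit_one_sub [Fintype α] [DecidableEq α] {N : TF α α} (hN : DegLE (-1) N) :
    IsUnit (1 - N) ∧ DegLE 0 (1 - N)⁻¹ := by
  let O := (inftyVal).valuationSubring
  have hlt : ∀ i j, inftyVal (N i j) < 1 := fun i j =>
    (hN i j).trans_lt (by rw [← exp_zero, exp_lt_exp]; norm_num)
  let N' : Matrix α α O := Matrix.of fun i j => ⟨N i j, (hlt i j).le⟩
  have hmap : (O.subtype.mapMatrix (1 - N') : TF α α) = 1 - N := by
    rw [map_sub, map_one]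
    rfl
  have hres : (IsLocalRing.residue O).mapMatrix (1 - N') = 1 := by
    rw [map_sub, map_one, sub_eq_self]
    ext i j
    have : N' i j ∈ IsLocalRing.maximalIdeal O :=
      (Valuation.mem_maximalIdeal_iff (v := inftyVal)).2 (hlt i j)
    simpa using this
  have hdet : IsUnit (1 - N').det := by
    rw [← IsLocalRing.residue_ne_zero_iff_isUnit, RingHom.map_det, hres, det_one]
    exact one_ne_zero
  have hmul : (1 - N) * O.subtype.mapMatrix (1 - N')⁻¹ = 1 := by
    rw [← hmap, ← map_mul, Matrix.mul_nonsing_inv _ hdet, map_one]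
  refine ⟨IsUnit.of_mul_eq_one _ hmul, ?_⟩
  rw [Matrix.inv_eq_right_inv hmul]
  exact fun i j => ((1 - N')⁻¹ i j).2

end DegLE

/-! ### Constant matrices, resolvents and state equations -/

section Const

theorem const_mul [Fintype β] (M : Matrix α β ℝ) (N : Matrix β γ ℝ) :
    const (M * N) = const M * const N := Matrix.map_mul

theorem const_add (M N : Matrix α β ℝ) : const (M + N) = const M + const N :=
  Matrix.map_add _ (map_add _) _ _

theorem const_one [DecidableEq α] : const (1 : Matrix α α ℝ) = 1 :=
  Matrix.map_one _ (map_zero _) (map_one _)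

theorem const_zero : const (0 : Matrix α β ℝ) = 0 :=
  Matrix.map_zero _ (map_zero _)

end Const

section Resolvent

variable {n : ℕ} (A : Matrix (Fin n) (Fin n) ℝ)

theorem X_smul_one_sub_const :
    (RatFunc.X : RatFunc ℝ) • (1 : TF (Fin n) (Fin n)) - const A =
      (RatFunc.X : RatFunc ℝ) • (1 - (RatFunc.X : RatFunc ℝ)⁻¹ • const A) := by
  rw [smul_sub, smul_smul, mul_inv_cancel₀ RatFunc.X_ne_zero, one_smul]

theorem degLE_X_inv_smul_const : DegLE (-1) ((RatFunc.X : RatFunc ℝ)⁻¹ • const A) := fun i j => by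
  rw [Matrix.smul_apply, smul_eq_mul, map_mul, map_inv₀, inftyVal_X, ← WithZero.exp_neg]
  exact mul_le_of_le_one_right' (DegLE.const A i j)

theorem isUnit_X_smul_one_sub_const :
    IsUnit ((RatFunc.X : RatFunc ℝ) • (1 : TF (Fin n) (Fin n)) - const A) := by
  rw [X_smul_one_sub_const]
  exact ((degLE_X_inv_smul_const A).isUnit_one_sub.1).smul (Units.mk0 (RatFunc.X : RatFunc ℝ) RatFunc.X_ne_zero)

theorem degLE_resolvent : DegLE (-1) (resolvent A) := by
  have h := (degLE_X_inv_smul_const A).isUnit_one_sub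
  have : resolvent A = (RatFunc.X : RatFunc ℝ)⁻¹ • (1 - (RatFunc.X : RatFunc ℝ)⁻¹ • const A)⁻¹ := by
    rw [resolvent, X_smul_one_sub_const]
    apply Matrix.inv_eq_right_inv
    rw [Matrix.smul_mul, Matrix.mul_smul, smul_smul, mul_inv_cancel₀ RatFunc.X_ne_zero, one_smul,
      Matrix.mul_nonsing_inv _ ((Matrix.isUnit_iff_isUnit_det _).1 h.1)]
  rw [this]
  intro i j
  rw [Matrix.smul_apply, smul_eq_mul, map_mul, map_inv₀, inftyVal_X, ← WithZero.exp_neg]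
  exact mul_le_of_le_one_right' (h.2 i j)

/-- `X = (sI - A)⁻¹ M` solves the state equation `s X = A X + M`. -/
theorem X_smul_eq_iff {M X : TF (Fin n) α} :
    (RatFunc.X : RatFunc ℝ) • X = const A * X + M ↔ X = resolvent A * M := by
  have h := (Matrix.isUnit_iff_isUnit_det _).1 (isUnit_X_smul_one_sub_const A)
  constructor
  · intro hX
    have : ((RatFunc.X : RatFunc ℝ) • (1 : TF (Fin n) (Fin n)) - const A) * X = M := by
      rw [Matrix.sub_mul, Matrix.smul_mul, Matrix.one_mul, hX, add_sub_cancel_left]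
    rw [← this, resolvent, Matrix.nonsing_inv_mul_cancel_left _ _ h]
  · rintro rfl
    have := Matrix.mul_nonsing_inv_cancel_left _ M h
    rw [Matrix.sub_mul, Matrix.smul_mul, Matrix.one_mul, sub_eq_iff_eq_add'] at this
    exact this

/-- Repeated differentiation of the outputs of `s X = A X + M`. -/
theorem X_pow_mul_output {M : Matrix (Fin n) α ℝ} {X : TF (Fin n) α} [Fintype β]
    (hX : (RatFunc.X : RatFunc ℝ) • X = const A * X + const M) (C : Matrix β (Fin n) ℝ)
    (j : ℕ) (i : β) (a : α) :
    (RatFunc.X : RatFunc ℝ) ^ j * (const C * X) i a =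
      (const (C * A ^ j) * X) i a +
        ∑ l ∈ Finset.range j, RatFunc.C ((C * A ^ (j - 1 - l) * M) i a) * RatFunc.X ^ l := by
  induction j with
  | zero => simp
  | succ j ih =>
    have hstep : (RatFunc.X : RatFunc ℝ) * (const (C * A ^ j) * X) i a =
        (const (C * A ^ (j + 1)) * X) i a + RatFunc.C ((C * A ^ j * M) i a) := by
      have h := congrArg (fun Y => (const (C * A ^ j) * Y) i a) hX
      simp only [Matrix.mul_smul, Matrix.mul_add, Matrix.smul_apply, Matrix.add_apply,
        smul_eq_mul, ← const_mul, ← Matrix.mul_assoc] at h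
      rw [h, pow_succ, ← Matrix.mul_assoc C]
      rfl
    rw [pow_succ', mul_assoc, ih, mul_add, hstep, Finset.sum_range_succ', Finset.mul_sum]
    simp only [add_tsub_cancel_right, tsub_zero, pow_zero, mul_one]
    rw [add_assoc, add_comm (RatFunc.C _)]
    congr 2
    refine Finset.sum_congr rfl fun l hl => ?_
    rw [show j - (l + 1) = j - 1 - l by omega, pow_succ']
    ring

end Resolvent

end Retrofit

end

noncomputable section

namespace Retrofit

open Matrix WithZero

/-! ### Splitting the outputs into `P y` and `P̄ y` -/

section Selection

variable {α β : Type} (m k : ℕ)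

theorem const_P_mul_apply (M : TF (Fin (m + k)) α) (j : Fin k) (a : α) :
    (const (P m k) * M) j a = M (Fin.natAdd m j) a := by
  simp [Matrix.mul_apply, const, P, Matrix.one_apply]

theorem const_Pbar_mul_apply (M : TF (Fin (m + k)) α) (i : Fin m) (a : α) :
    (const (Pbar m k) * M) i a = M (Fin.castAdd k i) a := by
  simp [Matrix.mul_apply, const, Pbar, Matrix.one_apply]

theorem mul_const_P_transpose_apply (M : TF α (Fin (m + k))) (a : α) (j : Fin k) :
    (M * const (P m k)ᵀ) a j = M a (Fin.natAdd m j) := by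
  simp [Matrix.mul_apply, const, P, Matrix.one_apply]

theorem mul_const_Pbar_transpose_apply (M : TF α (Fin (m + k))) (a : α) (i : Fin m) :
    (M * const (Pbar m k)ᵀ) a i = M a (Fin.castAdd k i) := by
  simp [Matrix.mul_apply, const, Pbar, Matrix.one_apply]

theorem natAdd_ne_castAdd {m k : ℕ} (j : Fin k) (i : Fin m) :
    Fin.natAdd m j ≠ Fin.castAdd k i := fun h => by
  have := congrArg Fin.val h
  simp only [Fin.val_natAdd, Fin.val_castAdd] at this
  omega

theorem const_P_mul_transpose : const (P m k) * const (P m k)ᵀ = 1 := by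
  ext i j
  rw [const_P_mul_apply]
  simp [const, P, Matrix.one_apply]

theorem const_Pbar_mul_P_transpose : const (Pbar m k) * const (P m k)ᵀ = 0 := by
  ext i j
  rw [const_Pbar_mul_apply]
  simp [const, P, (natAdd_ne_castAdd _ _).symm]

theorem const_P_mul_Pbar_transpose : const (P m k) * const (Pbar m k)ᵀ = 0 := by
  ext j i
  rw [const_P_mul_apply]
  simp [const, Pbar, natAdd_ne_castAdd]

theorem const_Pbar_mul_transpose : const (Pbar m k) * const (Pbar m k)ᵀ = 1 := by
  ext i j
  rw [const_Pbar_mul_apply]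
  simp [const, Pbar, Matrix.one_apply]

theorem mul_eq_add_of_selection (K : TF α (Fin (m + k))) (Y : TF (Fin (m + k)) β) :
    K * Y = K * const (P m k)ᵀ * (const (P m k) * Y) +
      K * const (Pbar m k)ᵀ * (const (Pbar m k) * Y) := by
  ext a b
  rw [Matrix.add_apply, Matrix.mul_apply, Matrix.mul_apply, Matrix.mul_apply, Fin.sum_univ_add,
    add_comm]
  simp only [mul_const_P_transpose_apply, mul_const_Pbar_transpose_apply, const_P_mul_apply,
    const_Pbar_mul_apply]

end Selection

/-! ### Zero dynamics and the rectifier -/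

namespace Subsystem

variable {n m k q : ℕ} {G : Subsystem n m k q} {r : Fin (m + k) → ℕ}

theorem Gyv_eq (G : Subsystem n m k q) :
    G.Gyv = const G.C * (resolvent G.A * const G.L) := Matrix.mul_assoc _ _ _

theorem Gyu_eq (G : Subsystem n m k q) :
    G.Gyu = const G.C * (resolvent G.A * const G.B) := Matrix.mul_assoc _ _ _

theorem degLE_Gyu (G : Subsystem n m k q) : DegLE (-1) G.Gyu :=
  ((DegLE.const G.C).mul (degLE_resolvent G.A)).mul (DegLE.const G.B)

/-- `D_ξ P̄ y` collects the derivatives of the first `m` outputs. -/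
theorem Dxi_mul_Pbar_mul_apply {α : Type} (Y : TF (Fin (m + k)) α) (x : XiIdx m k r) (a : α) :
    (Dxi m k r * (const (Pbar m k) * Y)) x a =
      (RatFunc.X : RatFunc ℝ) ^ (x.2 : ℕ) * Y (Fin.castAdd k x.1) a := by
  rw [Matrix.mul_apply]
  simp [Dxi, const_Pbar_mul_apply]

theorem const_S_mul_apply {α : Type} (G : Subsystem n m k q) (X : TF (Fin n) α)
    (x : XiIdx m k r) (a : α) :
    (const (G.S r) * X) x a = (const (G.C * G.A ^ (x.2 : ℕ)) * X) (Fin.castAdd k x.1) a := rfl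

theorem ZD_apply (G : Subsystem n m k q) (x : XiIdx m k r) (c : Fin q) :
    G.ZD r x c = ∑ l ∈ Finset.range (x.2 : ℕ),
      RatFunc.C ((G.C * G.A ^ ((x.2 : ℕ) - 1 - l) * G.B) (Fin.castAdd k x.1) c) *
        (RatFunc.X : RatFunc ℝ) ^ l := by
  obtain ⟨i, j, hj⟩ := x
  rw [ZD, Matrix.of_apply, Matrix.mul_apply, Fintype.sum_prod_type]
  simp only [Dhat, const, Matrix.map_apply, Matrix.of_apply, Z, mul_ite, mul_zero,
    Finset.sum_ite_eq', Finset.mem_univ, if_true]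
  rw [Fin.sum_univ_eq_sum_range (fun l => RatFunc.C (if l < j then
    (G.C * G.A ^ (j - 1 - l) * G.B) (Fin.castAdd k i) c else 0) * (RatFunc.X : RatFunc ℝ) ^ l)]
  rw [← Finset.sum_subset (Finset.range_subset_range.2 hj.le)]
  · exact Finset.sum_congr rfl fun l hl => by rw [if_pos (Finset.mem_range.1 hl)]
  · intro l _ hl
    rw [if_neg (by simpa using hl), map_zero, zero_mul]

/-- Differentiating `y_i` fewer than `r_i` times never brings in `v`: the Markov parameters that
would appear have exponent at most `r_i - 2`. -/
theorem const_S_mul_resolvent_L (hr : HasRelativeDegree G.A G.L G.C r) :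
    const (G.S r) * (resolvent G.A * const G.L) = Dxi m k r * (const (Pbar m k) * G.Gyv) := by
  ext x a
  rw [Dxi_mul_Pbar_mul_apply, Gyv_eq, X_pow_mul_output G.A ((X_smul_eq_iff G.A).2 rfl),
    const_S_mul_apply, Finset.sum_eq_zero, add_zero]
  intro l hl
  have := x.2.2
  have hl := Finset.mem_range.1 hl
  rw [hr.2.1 _ _ (by omega), Pi.zero_apply, map_zero, zero_mul]

/-- For the input `u` the Markov parameters need not vanish; `ZD` collects exactly these terms. -/
theorem const_S_mul_resolvent_B (G : Subsystem n m k q) (r : Fin (m + k) → ℕ) :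
    const (G.S r) * (resolvent G.A * const G.B) =
      Dxi m k r * (const (Pbar m k) * G.Gyu) - G.ZD r := by
  ext x a
  rw [Matrix.sub_apply, Dxi_mul_Pbar_mul_apply, Gyu_eq,
    X_pow_mul_output G.A ((X_smul_eq_iff G.A).2 rfl), const_S_mul_apply, ZD_apply,
    add_sub_cancel_right]

/-- The high-frequency expansion of the rows of `G_yv`. -/
theorem X_pow_mul_Gyv (hr : HasRelativeDegree G.A G.L G.C r) (i : Fin (m + k)) (a : Fin m) :
    (RatFunc.X : RatFunc ℝ) ^ r i * G.Gyv i a =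
      RatFunc.C ((G.C * G.A ^ (r i - 1) * G.L) i a) +
        (const (G.C * G.A ^ r i) * (resolvent G.A * const G.L)) i a := by
  rw [Gyv_eq, X_pow_mul_output G.A ((X_smul_eq_iff G.A).2 rfl), add_comm]
  congr 1
  -- Only `l = 0` reaches the exponent `r_i - 1`; larger `l` give vanishing Markov parameters.
  rw [Finset.sum_eq_single 0, pow_zero, mul_one, tsub_zero]
  · intro l hl h0
    have hl := Finset.mem_range.1 hl
    rw [hr.2.1 _ _ (by omega), Pi.zero_apply, map_zero, zero_mul]
  · intro h
    have := hr.1 i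
    exact absurd (Finset.mem_range.2 (by omega)) h

theorem degLE_const_mul_resolvent_mul_const {a b : Type} (C : Matrix a (Fin n) ℝ)
    (A : Matrix (Fin n) (Fin n) ℝ) (M : Matrix (Fin n) b ℝ) :
    DegLE (-1) (const C * (resolvent A * const M)) :=
  (DegLE.const C).mul ((degLE_resolvent A).mul (DegLE.const M))

theorem inftyVal_Gyv_le (hr : HasRelativeDegree G.A G.L G.C r) (i : Fin (m + k)) (a : Fin m) :
    inftyVal (G.Gyv i a) ≤ exp (-(r i : ℤ)) := by
  have h : inftyVal (RatFunc.X ^ r i * G.Gyv i a) ≤ exp (0 : ℤ) := by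
    rw [X_pow_mul_Gyv hr]
    exact Valuation.map_add_le _ (inftyVal_C_le _)
      ((degLE_const_mul_resolvent_mul_const _ _ _).mono (by norm_num) i a)
  rw [map_mul, map_pow, inftyVal_X, ← WithZero.exp_nsmul] at h
  rw [← mul_le_mul_iff_right₀ (exp_pos (a := (r i • (1 : ℤ)))), ← exp_add]
  simpa using h

/-- The high-frequency gain of the first `m` outputs. -/
def gain (G : Subsystem n m k q) (r : Fin (m + k) → ℕ) : Matrix (Fin m) (Fin m) ℝ :=
  Matrix.of fun (i : Fin m) (a : Fin m) =>
      (G.C * G.A ^ (r (Fin.castAdd k i) - 1) * G.L) (Fin.castAdd k i) a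

theorem RelDegAssumption.isUnit_gain (hr : G.RelDegAssumption r) : IsUnit (G.gain r) :=
  Matrix.mulVec_injective_iff_isUnit.1 hr.2.2.2

/-- The square part `P̄ G_yv` is invertible, and its inverse is proper up to the factors
`s ^ r_i`. -/
theorem RelDegAssumption.exists_Pbar_Gyv_mul_eq_one (hr : G.RelDegAssumption r) :
    ∃ F : TF (Fin m) (Fin m), DegLE 0 F ∧
      const (Pbar m k) * G.Gyv *
        (F * Matrix.diagonal fun i => (RatFunc.X : RatFunc ℝ) ^ r (Fin.castAdd k i)) = 1 := by
  have hE := hr.isUnit_gain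
  rw [Matrix.isUnit_iff_isUnit_det] at hE
  let T : TF (Fin m) (Fin m) :=
    Matrix.diagonal fun i => (RatFunc.X : RatFunc ℝ) ^ r (Fin.castAdd k i)
  have hT : IsUnit T := by
    rw [Matrix.isUnit_iff_isUnit_det, Matrix.det_diagonal, isUnit_iff_ne_zero]
    exact Finset.prod_ne_zero_iff.2 fun i _ => pow_ne_zero _ RatFunc.X_ne_zero
  let N : TF (Fin m) (Fin m) := Matrix.of fun i a =>
    (const (G.C * G.A ^ r (Fin.castAdd k i)) * (resolvent G.A * const G.L)) (Fin.castAdd k i) a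
  have hN : DegLE (-1) N := fun i a => degLE_const_mul_resolvent_mul_const _ _ _ _ _
  -- Scaling row `i` by `s ^ r_i` leaves the invertible gain plus a strictly proper remainder, so
  -- the inverse of the sum is proper.
  have hTW : T * (const (Pbar m k) * G.Gyv) = const (G.gain r) + N := by
    ext i a
    rw [Matrix.diagonal_mul, const_Pbar_mul_apply, X_pow_mul_Gyv hr.1]
    rfl
  have hEN : DegLE (-1) (-(const (G.gain r)⁻¹ * N)) := ((DegLE.const _).mul hN).neg
  have hU := hEN.isUnit_one_sub
  rw [sub_neg_eq_add] at hU
  set U := 1 + const (G.gain r)⁻¹ * N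
  have hfac : const (G.gain r) * U = const (G.gain r) + N := by
    rw [Matrix.mul_add, Matrix.mul_one, ← Matrix.mul_assoc, ← const_mul,
      Matrix.mul_nonsing_inv _ hE, const_one, Matrix.one_mul]
  refine ⟨U⁻¹ * const (G.gain r)⁻¹, hU.2.mul (DegLE.const _), ?_⟩
  have h1 : T * ((const (Pbar m k) * G.Gyv) * (U⁻¹ * const (G.gain r)⁻¹)) = 1 := by
    rw [← Matrix.mul_assoc, hTW, ← hfac, Matrix.mul_assoc, Matrix.mul_nonsing_inv_cancel_left _ _
      ((Matrix.isUnit_iff_isUnit_det _).1 hU.1), ← const_mul, Matrix.mul_nonsing_inv _ hE,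
      const_one]
  rw [← Matrix.mul_assoc]
  exact mul_eq_one_comm.1 h1

namespace NormalForm

variable {ν : ℕ} (N : G.NormalForm r ν)

theorem Sdag_mul_S_add : N.Sdag * G.S r + N.Sbardag * N.Sbar = 1 := by
  rw [← Matrix.fromCols_mul_fromRows, N.left_inv]

/-- In the coordinates `(S x, S̄ x)`, the outputs `P y` are produced by the zero dynamics. -/
theorem P_mul_C_mul_resolvent {α : Type} (M : Matrix (Fin n) α ℝ) :
    const (P m k) * (const G.C * (resolvent G.A * const M)) =
      const N.Chat * resolvent N.Ahat * (const (N.Sbar * G.A * N.Sdag) *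
        (const (G.S r) * (resolvent G.A * const M)) + const (N.Sbar * M)) := by
  have hX := (X_smul_eq_iff G.A).2 (rfl : resolvent G.A * const M = _)
  set X := resolvent G.A * const M
  have hsplit : ∀ {β : Type} (Q : Matrix β (Fin n) ℝ), const Q * X =
      const (Q * N.Sdag) * (const (G.S r) * X) + const (Q * N.Sbardag) * (const N.Sbar * X) := by
    intro β Q
    rw [← Matrix.mul_assoc _ _ X, ← Matrix.mul_assoc _ _ X, ← const_mul, ← const_mul,
      ← Matrix.add_mul, ← const_add, Matrix.mul_assoc, Matrix.mul_assoc, ← Matrix.mul_add, N.Sdag_mul_S_add,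
      Matrix.mul_one]
  -- The `z`-part obeys its own state equation, driven by `ξ` and `S̄ M`.
  have hz : (RatFunc.X : RatFunc ℝ) • (const N.Sbar * X) = const N.Ahat * (const N.Sbar * X) +
      (const (N.Sbar * G.A * N.Sdag) * (const (G.S r) * X) + const (N.Sbar * M)) := by
    rw [← Matrix.mul_smul, hX, Matrix.mul_add, ← Matrix.mul_assoc, ← const_mul, ← const_mul,
      hsplit, Ahat]
    abel
  rw [Matrix.mul_assoc, ← (X_smul_eq_iff _).1 hz, ← Matrix.mul_assoc, ← const_mul, hsplit,
    N.PC_mul_Sdag, const_zero, Matrix.zero_mul, zero_add, Chat]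

/-- The rectifier removes the interconnection input. -/
theorem P_mul_Gyv (hr : HasRelativeDegree G.A G.L G.C r) :
    const (P m k) * G.Gyv = N.Gyvhat * (const (Pbar m k) * G.Gyv) := by
  rw [Gyv_eq, N.P_mul_C_mul_resolvent, const_S_mul_resolvent_L hr, N.Sbar_mul_L, const_zero,
    add_zero, ← Gyv_eq, Gyvhat]
  simp only [Matrix.mul_assoc]

theorem P_mul_Gyu :
    const (P m k) * G.Gyu = N.Gyvhat * (const (Pbar m k) * G.Gyu) + N.Gyuhat := by
  rw [Gyu_eq, N.P_mul_C_mul_resolvent, const_S_mul_resolvent_B, ← Gyu_eq, Gyvhat, Gyuhat]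
  simp only [Matrix.mul_assoc, const_mul, Matrix.mul_sub, Matrix.mul_add]
  abel

/-- `Ĝ_yv` is strictly proper. -/
theorem degLE_Gyvhat (hr : G.RelDegAssumption r) : DegLE (-1) N.Gyvhat := by
  obtain ⟨F, hF, h1⟩ := hr.exists_Pbar_Gyv_mul_eq_one
  -- The powers of `s` in `D_ξ` hide properness in the definition. Solving `P_mul_Gyv` for `Ĝ_yv`
  -- bounds entry `(j, i)` by degree `r_i - r_{m+j} ≤ -1`.
  have h : N.Gyvhat = const (P m k) * G.Gyv * F *
      Matrix.diagonal fun i => (RatFunc.X : RatFunc ℝ) ^ r (Fin.castAdd k i) := by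
    rw [N.P_mul_Gyv hr.1, Matrix.mul_assoc N.Gyvhat, Matrix.mul_assoc N.Gyvhat,
      Matrix.mul_assoc _ F, h1, Matrix.mul_one]
  intro j i
  rw [h, Matrix.mul_diagonal, map_mul, map_pow, inftyVal_X, ← WithZero.exp_nsmul]
  have hle : inftyVal ((const (P m k) * G.Gyv * F) j i) ≤ exp (-(r (Fin.natAdd m j) : ℤ)) := by
    rw [Matrix.mul_apply]
    refine Valuation.map_sum_le _ fun a _ => ?_
    rw [map_mul, const_P_mul_apply]
    exact mul_le_of_le_of_le_one (inftyVal_Gyv_le hr.1 _ _) (hF a i)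
  refine (mul_le_mul_left hle _).trans ?_
  rw [← exp_add, exp_le_exp, nsmul_eq_mul, mul_one]
  have := hr.2.2.1 i j
  omega

/-- `Ĝ_yu` is strictly proper. -/
theorem degLE_Gyuhat (hr : G.RelDegAssumption r) : DegLE (-1) N.Gyuhat := by
  rw [← sub_eq_of_eq_add' N.P_mul_Gyu]
  exact ((DegLE.const _).mul G.degLE_Gyu).sub (((N.degLE_Gyvhat hr).mul
    ((DegLE.const _).mul G.degLE_Gyu)).mono (by norm_num))

theorem R_mul_fromRows :
    N.R * Matrix.fromRows (const (P m k)) (const (Pbar m k)) =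
      const (P m k) - N.Gyvhat * const (Pbar m k) := by
  rw [R, Matrix.fromCols_mul_fromRows, Matrix.one_mul, Matrix.neg_mul, sub_eq_add_neg]

theorem R_mul_fromRows_mul_Gyv (hr : HasRelativeDegree G.A G.L G.C r) :
    N.R * Matrix.fromRows (const (P m k)) (const (Pbar m k)) * G.Gyv = 0 := by
  rw [R_mul_fromRows, Matrix.sub_mul, Matrix.mul_assoc, ← N.P_mul_Gyv hr, sub_self]

theorem R_mul_fromRows_mul_Gyu :
    N.R * Matrix.fromRows (const (P m k)) (const (Pbar m k)) * G.Gyu = N.Gyuhat := by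
  rw [R_mul_fromRows, Matrix.sub_mul, Matrix.mul_assoc, N.P_mul_Gyu, add_sub_cancel_left]

/-- The rectifier parametrizes the controllers which annihilate `G_yv`. -/
theorem eq_mul_R_of_mul_Gyv_eq_zero (hr : G.RelDegAssumption r) {K : TF (Fin q) (Fin (m + k))}
    (hK : K * G.Gyv = 0) :
    K = K * const (P m k)ᵀ * N.R * Matrix.fromRows (const (P m k)) (const (Pbar m k)) := by
  obtain ⟨F, -, h1⟩ := hr.exists_Pbar_Gyv_mul_eq_one
  have h0 : (K * const (P m k)ᵀ * N.Gyvhat + K * const (Pbar m k)ᵀ) *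
      (const (Pbar m k) * G.Gyv) = 0 := by
    rw [← hK, mul_eq_add_of_selection m k K G.Gyv, N.P_mul_Gyv hr.1, Matrix.add_mul,
      Matrix.mul_assoc _ N.Gyvhat]
  -- Cancelling the invertible `P̄ G_yv` shows that the block `K Pᵀ` determines the block `K P̄ᵀ`.
  have h2 : K * const (P m k)ᵀ * N.Gyvhat + K * const (Pbar m k)ᵀ = 0 := by
    rw [← Matrix.mul_one (_ + _), ← h1, ← Matrix.mul_assoc, h0, Matrix.zero_mul]
  have h3 := mul_eq_add_of_selection m k K (1 : TF (Fin (m + k)) (Fin (m + k)))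
  simp only [Matrix.mul_one] at h3
  rw [← neg_eq_of_add_eq_zero_right h2] at h3
  rw [Matrix.mul_assoc _ N.R, R_mul_fromRows, Matrix.mul_sub, ← Matrix.mul_assoc _ N.Gyvhat,
    sub_eq_add_neg, ← Matrix.neg_mul]
  exact h3

end NormalForm

end Subsystem

/-! ### Stability of the closed loop -/

theorem isRHInf_entry_neg {x : RatFunc ℝ}
    (hx : x.num.natDegree ≤ x.denom.natDegree ∧
      ∀ z : ℂ, Polynomial.aeval z x.denom = 0 → z.re < 0) :
    (-x).num.natDegree ≤ (-x).denom.natDegree ∧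
      ∀ z : ℂ, Polynomial.aeval z (-x).denom = 0 → z.re < 0 := by
  refine ⟨?_, fun z hz => hx.2 z ?_⟩
  · rw [num_natDegree_le_iff, Valuation.map_neg, ← num_natDegree_le_iff]
    exact hx.1
  · have hd : (-x).denom ∣ x.denom := by
      rw [RatFunc.denom_dvd x.denom_ne_zero]
      exact ⟨-x.num, by rw [map_neg, neg_div, RatFunc.num_div_denom]⟩
    exact Polynomial.aeval_eq_zero_of_dvd_aeval_eq_zero hd hz

/-- `P` and `P̄` select complementary columns, so the difference lists the columns of `Q` and of
`-Q'` side by side, with no cancellation between them. -/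
theorem isRHInf_sub_iff {m k q : ℕ} (Q : TF (Fin q) (Fin k)) (Q' : TF (Fin q) (Fin m)) :
    IsRHInf (Q * const (P m k) - Q' * const (Pbar m k)) ↔ IsRHInf Q ∧ IsRHInf Q' := by
  set T := Q * const (P m k) - Q' * const (Pbar m k) with hT
  have h1 : ∀ i j, T i (Fin.natAdd m j) = Q i j := fun i j => by
    rw [← mul_const_P_transpose_apply m k T, hT, Matrix.sub_mul, Matrix.mul_assoc, Matrix.mul_assoc,
      const_P_mul_transpose, const_Pbar_mul_P_transpose, Matrix.mul_one, Matrix.mul_zero, sub_zero]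
  have h2 : ∀ i j, T i (Fin.castAdd k j) = -Q' i j := fun i j => by
    rw [← mul_const_Pbar_transpose_apply m k T, hT, Matrix.sub_mul, Matrix.mul_assoc, Matrix.mul_assoc,
      const_P_mul_Pbar_transpose, const_Pbar_mul_transpose, Matrix.mul_one, Matrix.mul_zero,
      zero_sub, Matrix.neg_apply]
  constructor
  · intro h
    refine ⟨⟨fun i j => ?_, fun i j => ?_⟩, fun i j => ?_, fun i j => ?_⟩
    · exact h1 i j ▸ h.1 i (Fin.natAdd m j)
    · exact h1 i j ▸ h.2 i (Fin.natAdd m j)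
    · exact neg_neg (Q' i j) ▸ (isRHInf_entry_neg
        ⟨h2 i j ▸ h.1 i (Fin.castAdd k j), h2 i j ▸ h.2 i (Fin.castAdd k j)⟩).1
    · exact neg_neg (Q' i j) ▸ (isRHInf_entry_neg
        ⟨h2 i j ▸ h.1 i (Fin.castAdd k j), h2 i j ▸ h.2 i (Fin.castAdd k j)⟩).2
  · rintro ⟨hQ, hQ'⟩
    refine ⟨fun i j => ?_, fun i j => ?_⟩ <;> induction j using Fin.addCases with
    | left j =>
      rw [h2]
      first
      | exact (isRHInf_entry_neg ⟨hQ'.1 i j, hQ'.2 i j⟩).1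
      | exact (isRHInf_entry_neg ⟨hQ'.1 i j, hQ'.2 i j⟩).2
    | right j =>
      rw [h1]
      first
      | exact hQ.1 i j
      | exact hQ.2 i j

theorem Subsystem.NormalForm.isRHInf_iff {n m k q ν : ℕ} {G : Subsystem n m k q}
    {r : Fin (m + k) → ℕ} (N : G.NormalForm r ν) {K : TF (Fin q) (Fin (m + k))}
    {Khat : TF (Fin q) (Fin k)}
    (hK : K = Khat * N.R * Matrix.fromRows (const (P m k)) (const (Pbar m k))) :
    IsRHInf ((1 - K * G.Gyu)⁻¹ * K) ↔
      IsRHInf (N.Qhat Khat) ∧ IsRHInf (N.Qhat Khat * N.Gyvhat) := by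
  have h1 : K * G.Gyu = Khat * N.Gyuhat := by
    rw [hK, Matrix.mul_assoc Khat, Matrix.mul_assoc Khat, N.R_mul_fromRows_mul_Gyu]
  rw [h1, hK, Matrix.mul_assoc Khat, ← Matrix.mul_assoc _ Khat, N.R_mul_fromRows, Matrix.mul_sub,
    ← Matrix.mul_assoc _ N.Gyvhat, isRHInf_sub_iff]
  rfl

end Retrofit

end

/-! ### Existence of the normal form -/

noncomputable section

namespace Retrofit

open Matrix

/-- A real idempotent matrix factors through its range. -/
theorem exists_factorization_of_idempotent {n : ℕ} {E : Matrix (Fin n) (Fin n) ℝ}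
    (hE : E * E = E) :
    ∃ (ν : ℕ) (U : Matrix (Fin n) (Fin ν) ℝ) (W : Matrix (Fin ν) (Fin n) ℝ),
      U * W = E ∧ W * U = 1 := by
  let f := Matrix.toLin' E
  let b := Module.finBasis ℝ (LinearMap.range f)
  let e := Pi.basisFun ℝ (Fin n)
  refine ⟨_, LinearMap.toMatrix b e (LinearMap.range f).subtype,
    LinearMap.toMatrix e b f.rangeRestrict, ?_, ?_⟩
  · rw [← LinearMap.toMatrix_comp, LinearMap.subtype_comp_codRestrict]
    exact LinearMap.toMatrix'_toLin' E
  · rw [← LinearMap.toMatrix_comp]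
    convert LinearMap.toMatrix_id b
    ext1 ⟨x, y, hy⟩
    refine Subtype.ext ?_
    subst hy
    change f (f y) = f y
    rw [← LinearMap.comp_apply, ← Matrix.toLin'_mul, hE]

namespace Subsystem

variable {n m k q : ℕ} {G : Subsystem n m k q} {r : Fin (m + k) → ℕ}

/-- The columns `A ^ (r_i - 1 - j) L e_i`, normalized by the high-frequency gain; they are dual to
the rows of `S` up to a unitriangular factor. -/
def reach (G : Subsystem n m k q) (r : Fin (m + k) → ℕ) : Matrix (Fin n) (XiIdx m k r) ℝ :=
  Matrix.of fun l x =>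
    (G.A ^ (r (Fin.castAdd k x.1) - 1 - x.2) * G.L * (G.gain r)⁻¹) l x.1

theorem mul_reach_apply {α : Type} (M : Matrix α (Fin n) ℝ) (a : α) (x : XiIdx m k r) :
    (M * G.reach r) a x =
      (M * G.A ^ (r (Fin.castAdd k x.1) - 1 - x.2) * G.L * (G.gain r)⁻¹) a x.1 := by
  rw [Matrix.mul_assoc M, Matrix.mul_assoc M]
  rfl

theorem S_mul_reach_apply (x y : XiIdx m k r) :
    (G.S r * G.reach r) x y =
      (G.C * G.A ^ (x.2 + (r (Fin.castAdd k y.1) - 1 - y.2)) * G.L * (G.gain r)⁻¹)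
        (Fin.castAdd k x.1) y.1 := by
  rw [pow_add, ← Matrix.mul_assoc G.C, ← mul_reach_apply]
  rfl

theorem mul_apply_eq_zero_of_row {α β γ : Type} [Fintype β] {M : Matrix α β ℝ} {a : α}
    (h : M a = 0) (N : Matrix β γ ℝ) (c : γ) : (M * N) a c = 0 := by
  rw [Matrix.mul_apply]
  exact Finset.sum_eq_zero fun b _ => by rw [h, Pi.zero_apply, zero_mul]

/-- Order the indices `(i, j)` by `r_i - 1 - j`. An entry whose row exceeds its column in this order
is a Markov parameter of exponent below `r_i - 1`, hence zero; at equal depth the exponent is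
exactly `r_i - 1`, and the normalization by the gain makes the diagonal blocks identities. -/
theorem RelDegAssumption.isUnit_det_S_mul_reach (hr : G.RelDegAssumption r) :
    IsUnit (G.S r * G.reach r).det := by
  let depth : XiIdx m k r → ℕ := fun x => r (Fin.castAdd k x.1) - 1 - x.2
  have htri : (G.S r * G.reach r).BlockTriangular depth := by
    intro x y hxy
    rw [S_mul_reach_apply]
    refine mul_apply_eq_zero_of_row (hr.1.2.1 _ _ ?_) _ _
    have := x.2.2
    simp only [depth] at hxy
    omega
  have hblock : ∀ d, (G.S r * G.reach r).toSquareBlock depth d = 1 := by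
    rintro d
    ext ⟨⟨i, j⟩, hx⟩ ⟨⟨i', j'⟩, hy⟩
    have hj := j.2
    have hj' := j'.2
    simp only [depth] at hx hy
    have hexp : (j : ℕ) + (r (Fin.castAdd k i') - 1 - j') = r (Fin.castAdd k i) - 1 := by omega
    rw [Matrix.toSquareBlock_def, Matrix.of_apply, S_mul_reach_apply, hexp]
    have : (G.C * G.A ^ (r (Fin.castAdd k i) - 1) * G.L * (G.gain r)⁻¹) (Fin.castAdd k i) i' =
        (G.gain r * (G.gain r)⁻¹) i i' := rfl
    rw [this, Matrix.mul_nonsing_inv _ ((Matrix.isUnit_iff_isUnit_det _).1 hr.isUnit_gain)]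
    by_cases h : i = i'
    · subst h
      have : j = j' := Fin.ext (by omega)
      subst this
      simp
    · rw [Matrix.one_apply_ne h, Matrix.one_apply_ne]
      exact fun h' => h (congrArg (fun z => z.1.1) h')
  rw [htri.det]
  simp [hblock]

/-- The powers of `A` in `reach` are at most `r_i - 1 ≤ r_{m+j} - 2`, too low for the last outputs
to respond. -/
theorem RelDegAssumption.P_mul_C_mul_reach (hr : G.RelDegAssumption r) :
    P m k * G.C * G.reach r = 0 := by
  ext j x
  have hP : (P m k * G.C * G.reach r) j x = (G.C * G.reach r) (Fin.natAdd m j) x := by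
    rw [Matrix.mul_assoc, Matrix.mul_apply]
    simp [P, Matrix.one_apply]
  rw [hP, mul_reach_apply]
  refine mul_apply_eq_zero_of_row (hr.1.2.1 _ _ ?_) _ _
  have := hr.2.2.1 x.1 j
  have := x.2.2
  omega

theorem RelDegAssumption.exists_reach_mul_eq_L (hr : G.RelDegAssumption r) :
    ∃ V : Matrix (XiIdx m k r) (Fin m) ℝ, G.reach r * V = G.L := by
  -- The columns with `j = r_i - 1` form `L * gain⁻¹`; `V` multiplies them by the gain and drops the
  -- others.
  refine ⟨Matrix.of fun x a =>
    if r (Fin.castAdd k x.1) - 1 - x.2 = 0 then G.gain r x.1 a else 0, ?_⟩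
  have hL : G.L = G.L * (G.gain r)⁻¹ * G.gain r := by
    rw [Matrix.mul_assoc, Matrix.nonsing_inv_mul _
      ((Matrix.isUnit_iff_isUnit_det _).1 hr.isUnit_gain), Matrix.mul_one]
  ext l a
  rw [hL, Matrix.mul_apply, Matrix.mul_apply (M := G.L * _), Fintype.sum_sigma]
  refine Finset.sum_congr rfl fun i _ => ?_
  have hi := hr.1.1 (Fin.castAdd k i)
  rw [Finset.sum_eq_single ⟨r (Fin.castAdd k i) - 1, by omega⟩]
  · simp [reach]
  · intro j _ hj
    have hj' := j.2
    have : (j : ℕ) ≠ r (Fin.castAdd k i) - 1 := fun h => hj (Fin.ext h)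
    rw [Matrix.of_apply, if_neg (by simp only; omega), mul_zero]
  · exact fun h => absurd (Finset.mem_univ _) h

theorem RelDegAssumption.exists_normalForm (hr : G.RelDegAssumption r) :
    ∃ ν : ℕ, Nonempty (G.NormalForm r ν) := by
  have hdet := hr.isUnit_det_S_mul_reach
  obtain ⟨V, hV⟩ := hr.exists_reach_mul_eq_L
  -- `D` is the right inverse of `S` with the same column span as `reach`, so `1 - D S` projects
  -- onto `ker S` and kills `L`. Factoring this projection as `U W` gives `S̄ = W`, `S† = D`, `S̄† =
  -- U`.
  set D := G.reach r * (G.S r * G.reach r)⁻¹ with hD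
  have hSD : G.S r * D = 1 := by rw [hD, ← Matrix.mul_assoc, Matrix.mul_nonsing_inv _ hdet]
  have hSE : G.S r * (1 - D * G.S r) = 0 := by
    rw [Matrix.mul_sub, ← Matrix.mul_assoc, hSD, Matrix.one_mul, Matrix.mul_one, sub_self]
  have hED : (1 - D * G.S r) * D = 0 := by
    rw [Matrix.sub_mul, Matrix.mul_assoc, hSD, Matrix.one_mul, Matrix.mul_one, sub_self]
  have hEL : (1 - D * G.S r) * G.L = 0 := by
    rw [Matrix.sub_mul, Matrix.one_mul, hD, ← hV, Matrix.mul_assoc, Matrix.mul_assoc,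
      ← Matrix.mul_assoc (G.S r), Matrix.nonsing_inv_mul_cancel_left _ _ hdet, sub_self]
  obtain ⟨ν, U, W, hUW, hWU⟩ := exists_factorization_of_idempotent
    (E := 1 - D * G.S r) (by rw [Matrix.mul_sub, Matrix.mul_one, ← Matrix.mul_assoc, hED,
      Matrix.zero_mul, sub_zero])
  have hW : W * (1 - D * G.S r) = W := by rw [← hUW, ← Matrix.mul_assoc, hWU, Matrix.one_mul]
  have hU : (1 - D * G.S r) * U = U := by rw [← hUW, Matrix.mul_assoc, hWU, Matrix.mul_one]
  refine ⟨ν, ⟨⟨W, D, U, ?_, ?_, ?_, ?_⟩⟩⟩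
  · rw [Matrix.fromRows_mul_fromCols, hSD, hWU, ← hU, ← Matrix.mul_assoc, hSE, Matrix.zero_mul,
      ← hW, Matrix.mul_assoc, hED, Matrix.mul_zero, Matrix.fromBlocks_one]
  · rw [Matrix.fromCols_mul_fromRows, hUW, add_sub_cancel]
  · rw [← hW, Matrix.mul_assoc, hEL, Matrix.mul_zero]
  · rw [hD, ← Matrix.mul_assoc, hr.P_mul_C_mul_reach, Matrix.zero_mul]

end Subsystem

end Retrofit

end

theorem theorem3 {n m k q : ℕ} (hk : 0 < k) (G : Retrofit.Subsystem n m k q)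
    (r : Fin (m + k) → ℕ) (hr : G.RelDegAssumption r) :
    (∃ ν : ℕ, Nonempty (G.NormalForm r ν)) ∧
    (∀ K : Retrofit.TF (Fin q) (Fin (m + k)), Retrofit.IsProper K → IsUnit (1 - K * G.Gyu)) ∧
    ∀ (ν : ℕ) (N : G.NormalForm r ν),
      Retrofit.IsProper N.Gyvhat ∧ Retrofit.IsProper N.Gyuhat ∧
      (∀ Khat : Retrofit.TF (Fin q) (Fin k), Retrofit.IsProper Khat →
        IsUnit (1 - Khat * N.Gyuhat)) ∧
      ∀ K : Retrofit.TF (Fin q) (Fin (m + k)), Retrofit.IsProper K →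
        (G.IsOutputRectifying K ↔
          ∃ Khat : Retrofit.TF (Fin q) (Fin k), Retrofit.IsProper Khat ∧
            K = Khat * N.R * Matrix.fromRows (Retrofit.const (Retrofit.P m k))
              (Retrofit.const (Retrofit.Pbar m k)) ∧
            Retrofit.IsRHInf (N.Qhat Khat) ∧
            Retrofit.IsRHInf (N.Qhat Khat * N.Gyvhat)) := by
  refine ⟨hr.exists_normalForm, fun K hK => ?_, fun ν N => ⟨?_, ?_, fun Khat hKhat => ?_,
    fun K hK => ⟨?_, ?_⟩⟩⟩
  · exact ((Retrofit.isProper_iff_degLE.1 hK).mul G.degLE_Gyu).isUnit_one_sub.1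
  · exact Retrofit.isProper_iff_degLE.2 ((N.degLE_Gyvhat hr).mono (by norm_num))
  · exact Retrofit.isProper_iff_degLE.2 ((N.degLE_Gyuhat hr).mono (by norm_num))
  · exact ((Retrofit.isProper_iff_degLE.1 hKhat).mul (N.degLE_Gyuhat hr)).isUnit_one_sub.1
  · rintro ⟨hKG, hQ⟩
    have hR := N.eq_mul_R_of_mul_Gyv_eq_zero hr hKG
    -- The witness, read off from `hR`, is `K̂ = K Pᵀ`.
    exact ⟨_, Retrofit.isProper_iff_degLE.2
      ((Retrofit.isProper_iff_degLE.1 hK).mul (Retrofit.DegLE.const _)), hR,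
      (N.isRHInf_iff hR).1 hQ⟩
  · rintro ⟨Khat, -, hR, hQ⟩
    refine ⟨?_, (N.isRHInf_iff hR).2 hQ⟩
    rw [hR, Matrix.mul_assoc Khat, Matrix.mul_assoc Khat, N.R_mul_fromRows_mul_Gyv hr.1,
      Matrix.mul_zero]
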